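/- Let $p$ be a prime and let $\alpha \ge 1$. Let $P \in \mathbb{Z}_p[x,y]$ satisfy $P(0,0)=0$ and $\frac{\partial P}{\partial y}(0,0) \not\equiv 0 \pmod p$, and let $F=\sum_{n\ge 0} a(n)x^n \in \mathbb{Z}_p[[x]]$ be the Furstenberg series associated with $P$, that is, the unique power series with $F(0)=0$ and $P(x,F)=0$. Let $h=\deg_x(P \bmod p)$ and $d=\deg_y(P \bmod p)$, and assume $h\ge 1$ and $d\ge 1$. Let $$u=\left\lfloor \log_p \max\bigl(\alpha(\deg_x(P \bmod p^\alpha)-h),\ \alpha(\deg_y(P \bmod p^\alpha)-d)+1\bigr)\right\rfloor+1.$$ Then the $p$-kernel $$\ker_p\bigl((a(n) \bmod p^\alpha)_{n\ge 0}\bigr)=\bigl\{(a(p^e n+r) \bmod p^\alpha)_{n\ge 0} : e\ge 0,\ 0\le r\le p^e-1\bigr\}$$ is finite, and $$\bigl|\ker_p\bigl((a(n) \bmod p^\alpha)_{n\ge 0}\bigr)\bigr| \le p^{\frac16\alpha(\alpha+1)\left((2hd-1)\alpha+(h+3)d+1\right)}+\frac{p^u-1}{p-1}.$$ -/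

import Mathlib

/-- `F ∈ ℤ_p⟦x⟧` is the Furstenberg series associated with `P ∈ ℤ_p[x, y]`
(variable `0` is `x`, variable `1` is `y`): `P(0, 0) = 0`, `∂P/∂y(0, 0) ≢ 0 mod p`,
`F(0) = 0` and `P(x, F) = 0`. For such `P`, exactly one `F` satisfies the last two conditions. -/
structure IsFurstenbergSeries {p : ℕ} [Fact p.Prime]
    (P : MvPolynomial (Fin 2) ℤ_[p]) (F : PowerSeries ℤ_[p]) : Prop where
  eval_zero : MvPolynomial.eval (fun _ => 0) P = 0
  pderiv_ne_zero :
    PadicInt.toZMod (MvPolynomial.eval (fun _ => 0) (MvPolynomial.pderiv 1 P)) ≠ 0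
  constantCoeff_eq_zero : PowerSeries.constantCoeff F = 0
  annihilates : MvPolynomial.aeval ![PowerSeries.X, F] P = 0

/-- The `p`-kernel of a sequence: the set of its subsequences `n ↦ a (p ^ e * n + r)` with
`e ≥ 0` and `0 ≤ r ≤ p ^ e - 1`. -/
def pKernel {R : Type*} (p : ℕ) (a : ℕ → R) : Set (ℕ → R) :=
  {b | ∃ e r : ℕ, r < p ^ e ∧ b = fun n => a (p ^ e * n + r)}

/-! By Furstenberg's theorem `F` is the diagonal of `N / q`, where `N = y P_y(xy, y)` and `q = P(xy,
y) / y`; the constant coefficient of `q` is `P_y(0, 0)`, a unit (`coeff_diag_furstenberg`). The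
Cartier operator at the exponent `(r, r)` replaces the diagonal `a(n)` by `a(p n + r)`, so it
suffices to find a small finite space that absorbs all long enough iterates of these operators on `N
/ q` modulo `p ^ α`.

Write `q = q₀ + p q₁`, where `q₀` keeps the coefficients prime to `p`. Expanding `1 / q`
geometrically makes `N / q` a sum of fractions `p ^ i T / q₀ ^ (i + 1)` with `i < α`
(`fraction_mem_stateSpace`). Since `q₀ ^ p ≡ q₀(x ^ p, y ^ p)` mod `p`, and Cartier operators are
linear over series in `x ^ p, y ^ p`, such sums are preserved, and the excess of the exponents of
`T` over those allowed by `q₀ ^ (i + 1)` is divided by `p` (`cartier_mem_stateSpace`). The initial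
excesses are the two terms of the maximum defining `u`, so they vanish after `u` steps.

In the space without excess, only `T` mod `p` matters at level `i`: a multiple of `p` moves to level
`i + 1` after multiplying numerator and denominator by `q₀`. Its size is therefore at most `p` to
the total number of lattice points available to the `T` (`stateSpace_finite_card`), which is the
stated exponent. The subsequences with `e < u` add at most `∑ p ^ e = (p ^ u - 1) / (p - 1)`. -/

/-! ### Weight bounds on exponents, and Cartier operators. -/

open MvPowerSeries in
/-- The power series all of whose exponents `n` satisfy `w n ≤ c`. -/
def weightLE {σ : Type*} (R : Type*) [CommRing R] (w : (σ →₀ ℕ) →+ ℤ) (c : ℤ) :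
    Submodule R (MvPowerSeries σ R) where
  carrier := {f | ∀ n, coeff n f ≠ 0 → w n ≤ c}
  add_mem' := by
    intro f g hf hg n hn
    by_cases h : coeff n f = 0
    · exact hg n fun h' => hn (by simp [h, h'])
    · exact hf n h
  zero_mem' := by
    intro n hn
    simp at hn
  smul_mem' := by
    intro r f hf n hn
    exact hf n fun h => hn (by simp [h])

namespace MvPowerSeries

variable {σ R : Type*} [CommRing R] {w : (σ →₀ ℕ) →+ ℤ} {c c' : ℤ} {f g : MvPowerSeries σ R}

theorem mem_weightLE : f ∈ weightLE R w c ↔ ∀ n, coeff n f ≠ 0 → w n ≤ c := Iff.rfl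

theorem weightLE_mono (h : c ≤ c') : weightLE R w c ≤ weightLE R w c' :=
  fun _ hf n hn => (hf n hn).trans h

theorem mul_mem_weightLE (hf : f ∈ weightLE R w c) (hg : g ∈ weightLE R w c') :
    f * g ∈ weightLE R w (c + c') := by
  classical
  intro n hn
  rw [coeff_mul] at hn
  obtain ⟨⟨i, j⟩, hij, hne⟩ := Finset.exists_ne_zero_of_sum_ne_zero hn
  rw [Finset.HasAntidiagonal.mem_antidiagonal] at hij
  have h1 := hf i (left_ne_zero_of_mul hne)
  have h2 := hg j (right_ne_zero_of_mul hne)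
  rw [← hij, map_add]
  exact add_le_add h1 h2

theorem one_mem_weightLE : (1 : MvPowerSeries σ R) ∈ weightLE R w 0 := by
  classical
  intro n hn
  rw [coeff_one] at hn
  by_cases h : n = 0
  · simp [h]
  · simp [h] at hn

theorem pow_mem_weightLE (hf : f ∈ weightLE R w c) (k : ℕ) :
    f ^ k ∈ weightLE R w (k * c) := by
  induction k with
  | zero => simpa using one_mem_weightLE
  | succ k ih =>
    rw [pow_succ]
    convert mul_mem_weightLE ih hf using 1
    push_cast
    ring_nf

/-- The inverse of a series with nonpositive weights has nonpositive weights. -/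
theorem inverse_mem_weightLE_zero (hf : f ∈ weightLE R w 0) (hfg : f * g = 1) :
    g ∈ weightLE R w 0 := by
  classical
  have hu : IsUnit (constantCoeff f) :=
    IsUnit.of_mul_eq_one (constantCoeff g) (by rw [← map_mul, hfg, map_one])
  have key : ∀ N : ℕ, ∀ n : σ →₀ ℕ, n.degree = N → coeff n g ≠ 0 → w n ≤ 0 := by
    intro N
    induction N using Nat.strong_induction_on with
    | _ N ih =>
      intro n hN hn
      by_contra! hw
      have hn0 : n ≠ 0 := by
        rintro rfl
        simp at hw
      have h1 : coeff n (f * g) = 0 := by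
        rw [hfg, coeff_one, if_neg hn0]
      -- In a term with `i ≠ 0`, the exponent `j` has smaller degree, so `w i ≤ 0` and `w j ≤ 0`
      -- contradict `w n > 0`. Only the unit `constantCoeff f` times `coeff n g` is left.
      rw [coeff_mul, Finset.sum_eq_single (0, n)] at h1
      · exact hn (hu.mul_right_eq_zero.mp h1)
      · rintro ⟨i, j⟩ hij hne
        rw [Finset.HasAntidiagonal.mem_antidiagonal] at hij
        by_contra h0
        have hi := hf i (left_ne_zero_of_mul h0)
        have hi0 : i ≠ 0 := by
          rintro rfl
          exact hne (by simpa using hij)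
        have hdeg : j.degree < N := by
          have h2 : i.degree + j.degree = N := by
            rw [← hN, ← hij]
            simp
          have h3 : i.degree ≠ 0 := fun h => hi0 ((Finsupp.degree_eq_zero_iff i).mp h)
          omega
        have hj := ih _ hdeg j rfl (right_ne_zero_of_mul h0)
        simp only at hij
        rw [← hij, map_add] at hw
        linarith
      · intro h
        simp at h
  exact fun n => key _ n rfl

theorem expand_mem_weightLE {p : ℕ} (hp : p ≠ 0) (hf : f ∈ weightLE R w c) :
    expand p hp f ∈ weightLE R w (p * c) := by
  intro n hn
  obtain ⟨m, hm, rfl⟩ := support_expand_subset p hp f hn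
  have := hf m hm
  rw [map_nsmul, nsmul_eq_mul]
  gcongr

/-- The power series with given coefficients. -/
def ofCoeff (φ : (σ →₀ ℕ) → R) : MvPowerSeries σ R := φ

@[simp]
theorem coeff_ofCoeff (φ : (σ →₀ ℕ) → R) (n : σ →₀ ℕ) : coeff n (ofCoeff φ) = φ n := rfl

/-- The Cartier operator extracting the coefficients at exponents `p • n + r`. -/
noncomputable def cartier (p : ℕ) (r : σ →₀ ℕ) : MvPowerSeries σ R →ₗ[R] MvPowerSeries σ R where
  toFun f := fun n => coeff (p • n + r) f
  map_add' _ _ := rfl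
  map_smul' _ _ := rfl

@[simp]
theorem coeff_cartier (p : ℕ) (r n : σ →₀ ℕ) (f : MvPowerSeries σ R) :
    coeff n (cartier p r f) = coeff (p • n + r) f := rfl

/-- Since `w r ≥ 0`, the bound at `p • n + r` also bounds `p * w n`; as `w n` is an integer,
dividing by `p` may round down. -/
theorem cartier_mem_weightLE {p : ℕ} (hp : p ≠ 0) {r : σ →₀ ℕ} (hr : 0 ≤ w r) {s : ℤ}
    (hf : f ∈ weightLE R w (p * c + s)) : cartier p r f ∈ weightLE R w (c + s / p) := by
  intro n hn
  have h1 := hf _ hn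
  rw [map_add, map_nsmul, nsmul_eq_mul] at h1
  have hp' : (0 : ℤ) < p := by positivity
  rw [← sub_le_iff_le_add', Int.le_ediv_iff_mul_le hp']
  linarith [mul_comm (w n - c) (p : ℤ), mul_sub (p : ℤ) (w n) c]

/-- A term of the product at `p • n + r` uses an exponent `p • m` of the expanded factor, and `r i <
p` forces `m ≤ n`; the other exponent is then `p • (n - m) + r`. -/
theorem cartier_mul_expand {p : ℕ} (hp : p ≠ 0) {r : σ →₀ ℕ} (hr : ∀ i, r i < p) :
    cartier p r (f * expand p hp g) = cartier p r f * g := by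
  classical
  ext n
  rw [coeff_cartier, coeff_mul, coeff_mul]
  symm
  apply Finset.sum_of_injOn (fun x => (p • x.1 + r, p • x.2))
  · rintro ⟨a, b⟩ - ⟨a', b'⟩ - h
    simp only [Prod.mk.injEq, add_left_inj] at h
    exact Prod.ext (nsmul_right_injective hp h.1) (nsmul_right_injective hp h.2)
  · rintro ⟨a, b⟩ h
    simp only [Finset.mem_coe, Finset.HasAntidiagonal.mem_antidiagonal] at h ⊢
    rw [← h, smul_add]
    abel
  · rintro ⟨a, b⟩ h hne
    rw [Finset.HasAntidiagonal.mem_antidiagonal] at h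
    by_contra h0
    obtain ⟨m, -, hm⟩ := support_expand_subset p hp g (right_ne_zero_of_mul h0)
    simp only at hm h
    subst hm
    have hle : m ≤ n := by
      intro i
      have h1 := DFunLike.congr_fun h i
      simp only [Finsupp.add_apply, Finsupp.smul_apply, smul_eq_mul] at h1
      have h2 : p * m i < p * (n i + 1) := by
        have := hr i
        rw [mul_add]
        omega
      exact Nat.lt_succ_iff.mp (Nat.lt_of_mul_lt_mul_left h2)
    obtain ⟨k, rfl⟩ := exists_add_of_le hle
    refine hne ⟨(k, m), ?_, ?_⟩
    · simp [add_comm]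
    · refine Prod.ext ?_ rfl
      simp only [smul_add] at h ⊢
      apply add_right_cancel (b := p • m)
      rw [h]
      abel
  · rintro ⟨a, b⟩ -
    simp

end MvPowerSeries

/-! ### Boxes of exponents, and stability of the state space under Cartier operators. -/

/-- The exponent of the variable `i`, as an integer-valued weight. -/
noncomputable def exponentWeight (i : Fin 2) : (Fin 2 →₀ ℕ) →+ ℤ :=
  (Nat.castAddMonoidHom ℤ).comp (Finsupp.applyAddHom i)

@[simp]
theorem exponentWeight_apply (i : Fin 2) (n : Fin 2 →₀ ℕ) : exponentWeight i n = n i := rfl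

/-- The bivariate series with exponents `(a, b)` such that `a ≤ A`, `a - b ≤ B`, `b - a ≤ C`. -/
noncomputable def boxLE (R : Type*) [CommRing R] (A B C : ℤ) : Submodule R (MvPowerSeries (Fin 2) R) :=
  weightLE R (exponentWeight 0) A ⊓ weightLE R (exponentWeight 0 - exponentWeight 1) B ⊓
    weightLE R (exponentWeight 1 - exponentWeight 0) C

namespace MvPowerSeries

variable {R : Type*} [CommRing R] {A B C A' B' C' : ℤ} {f g : MvPowerSeries (Fin 2) R}

theorem mem_boxLE : f ∈ boxLE R A B C ↔ ∀ n, coeff n f ≠ 0 →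
    (n 0 : ℤ) ≤ A ∧ (n 0 : ℤ) - n 1 ≤ B ∧ (n 1 : ℤ) - n 0 ≤ C := by
  simp only [boxLE, Submodule.mem_inf, mem_weightLE, AddMonoidHom.sub_apply, exponentWeight_apply]
  grind

theorem boxLE_mono (hA : A ≤ A') (hB : B ≤ B') (hC : C ≤ C') :
    boxLE R A B C ≤ boxLE R A' B' C' :=
  inf_le_inf (inf_le_inf (weightLE_mono hA) (weightLE_mono hB)) (weightLE_mono hC)

theorem mul_mem_boxLE (hf : f ∈ boxLE R A B C) (hg : g ∈ boxLE R A' B' C') :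
    f * g ∈ boxLE R (A + A') (B + B') (C + C') :=
  ⟨⟨mul_mem_weightLE hf.1.1 hg.1.1, mul_mem_weightLE hf.1.2 hg.1.2⟩, mul_mem_weightLE hf.2 hg.2⟩

theorem pow_mem_boxLE (hf : f ∈ boxLE R A B C) (k : ℕ) :
    f ^ k ∈ boxLE R (k * A) (k * B) (k * C) :=
  ⟨⟨pow_mem_weightLE hf.1.1 k, pow_mem_weightLE hf.1.2 k⟩, pow_mem_weightLE hf.2 k⟩

theorem expand_mem_boxLE {p : ℕ} (hp : p ≠ 0) (hf : f ∈ boxLE R A B C) :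
    expand p hp f ∈ boxLE R (p * A) (p * B) (p * C) :=
  ⟨⟨expand_mem_weightLE hp hf.1.1, expand_mem_weightLE hp hf.1.2⟩, expand_mem_weightLE hp hf.2⟩

/-- The exponent `(r, r)`. -/
noncomputable def diagExponent (r : ℕ) : Fin 2 →₀ ℕ := Finsupp.equivFunOnFinite.symm fun _ => r

@[simp]
theorem diagExponent_apply (r : ℕ) (i : Fin 2) : diagExponent r i = r := rfl

theorem cartier_mem_boxLE {p : ℕ} (hp : p ≠ 0) (r : ℕ) {s s' s'' : ℤ}
    (hf : f ∈ boxLE R (p * A + s) (p * B + s') (p * C + s'')) :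
    cartier p (diagExponent r) f ∈ boxLE R (A + s / p) (B + s' / p) (C + s'' / p) :=
  ⟨⟨cartier_mem_weightLE hp (by simp) hf.1.1, cartier_mem_weightLE hp (by simp) hf.1.2⟩,
    cartier_mem_weightLE hp (by simp) hf.2⟩

/-- The span of the fractions `p ^ i * T / q ^ (i + 1)` for `i ≥ k`, where `qi = 1 / q` and the
exponents of `T` exceed those of `q ^ (i + 1)` by at most `s` and `t`. -/
def stateSpace (p : ℕ) (qi : MvPowerSeries (Fin 2) R) (h d s t : ℤ) (k : ℕ) :
    Submodule R (MvPowerSeries (Fin 2) R) :=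
  Submodule.span R {v | ∃ i, k ≤ i ∧ ∃ T ∈ boxLE R (h * (i + 1) + s) i ((d - 1) * (i + 1) + t),
    v = (p : R) ^ i • (T * qi ^ (i + 1))}

variable {p α : ℕ} {q qi e : MvPowerSeries (Fin 2) R} {h d s t : ℤ} {k : ℕ}

theorem smul_mem_stateSpace {i : ℕ} (hi : k ≤ i) {T : MvPowerSeries (Fin 2) R}
    (hT : T ∈ boxLE R (h * (i + 1) + s) i ((d - 1) * (i + 1) + t)) :
    (p : R) ^ i • (T * qi ^ (i + 1)) ∈ stateSpace p qi h d s t k :=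
  Submodule.subset_span ⟨i, hi, T, hT, rfl⟩

/-- One application of the Cartier operator to a fraction whose denominator has been partly
replaced by the denominator `expand p q`. -/
theorem cartier_fraction_mem_stateSpace (hp : p ≠ 0) (hpα : (p : R) ^ α = 0) {r : ℕ} (hr : r < p)
    (hq : q * qi = 1) (he : q ^ p = expand p hp q + (p : R) • e)
    (hebox : e ∈ boxLE R (p * h) p (p * (d - 1))) (N : ℕ) :
    ∀ k : ℕ, α ≤ k + N → ∀ a b : ℕ, a + b = k + 1 → ∀ T ∈ boxLE R (p * (h * (k + 1)) + s)
      (p * k + (p - 1)) (p * ((d - 1) * (k + 1)) + t),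
      (p : R) ^ k • cartier p (diagExponent r) (T * qi ^ (p * a) * expand p hp qi ^ b) ∈
        stateSpace p qi h d (s / p) (t / p) 0 := by
  have hp0 : (0 : ℤ) < p := by positivity
  -- The outer induction is downward in `k`, starting where `p ^ k = 0`; the inner one is on the
  -- number `a` of factors `q ^ p` still to be replaced.
  induction N with
  | zero =>
    intro k hk a b _ T _
    rw [pow_eq_zero_of_le (by simpa using hk) hpα, zero_smul]
    exact zero_mem _
  | succ N ihN =>
    intro k hk a
    induction a with
    | zero =>
      intro b hb T hT
      rw [zero_add] at hb
      subst hb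
      rw [mul_zero, pow_zero, mul_one, ← map_pow, cartier_mul_expand hp (by simpa using hr)]
      refine smul_mem_stateSpace (Nat.zero_le k) ?_
      have := cartier_mem_boxLE hp r hT
      -- The slack `p - 1` in the bound on `n 0 - n 1` is lost to rounding, so this bound returns to
      -- exactly `k`.
      rwa [Int.ediv_eq_zero_of_lt (a := (p : ℤ) - 1) (by omega) (by omega), add_zero] at this
    | succ a iha =>
      intro b hb T hT
      have h1 : expand p hp q * expand p hp qi = 1 := by
        rw [← map_mul, hq, map_one]
      have h2 : q ^ p * qi ^ p = 1 := by
        rw [← mul_pow, hq, one_pow]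
      -- This is `1 / q ^ p = 1 / expand q - p e / (q ^ p * expand q)`. The main term lowers `a`;
      -- the error term gains a factor `p` and one more denominator, so it belongs to level `k + 1`.
      have h3 : T * qi ^ (p * (a + 1)) * expand p hp qi ^ b =
          T * qi ^ (p * a) * expand p hp qi ^ (b + 1) -
          (p : R) • (T * e * qi ^ (p * (a + 1)) * expand p hp qi ^ (b + 1)) := by
        have h4 : (p : R) • e = q ^ p - expand p hp q := by rw [he]; ring
        have h5 : (p : R) • (T * e * qi ^ (p * (a + 1)) * expand p hp qi ^ (b + 1)) =
          T * ((p : R) • e) * qi ^ (p * (a + 1)) * expand p hp qi ^ (b + 1) := by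
          simp only [mul_smul_comm, smul_mul_assoc]
        rw [h5, h4, mul_add, pow_add qi, mul_one, pow_succ _ b]
        linear_combination (-T * qi ^ (p * a) * qi ^ p * expand p hp qi ^ b) * h1 +
          (T * qi ^ (p * a) * expand p hp qi ^ b * expand p hp qi) * h2
      rw [h3, map_sub, map_smul, smul_sub, smul_smul, ← pow_succ]
      refine sub_mem (iha (b + 1) (by omega) T hT)
        (ihN (k + 1) (by omega) (a + 1) (b + 1) (by omega) _ ?_)
      refine boxLE_mono ?_ ?_ ?_ (mul_mem_boxLE hT hebox) <;> push_cast <;> linarith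

theorem cartier_mem_stateSpace (hp : p ≠ 0) (hpα : (p : R) ^ α = 0) {r : ℕ} (hr : r < p)
    (hq : q * qi = 1) (he : q ^ p = expand p hp q + (p : R) • e)
    (hebox : e ∈ boxLE R (p * h) p (p * (d - 1))) (hqbox : q ∈ boxLE R h 1 (d - 1))
    {v : MvPowerSeries (Fin 2) R} (hv : v ∈ stateSpace p qi h d s t 0) :
    cartier p (diagExponent r) v ∈ stateSpace p qi h d (s / p) (t / p) 0 := by
  suffices stateSpace p qi h d s t 0 ≤
      (stateSpace p qi h d (s / p) (t / p) 0).comap (cartier p (diagExponent r)) from this hv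
  refine Submodule.span_le.mpr ?_
  rintro _ ⟨k, -, T, hT, rfl⟩
  -- Write `T / q ^ (k + 1)` as `T q ^ ((p - 1) (k + 1)) / q ^ (p (k + 1))`, so that the denominator
  -- is a power of `q ^ p`.
  have h1 := cartier_fraction_mem_stateSpace (s := s) (t := t) hp hpα hr hq he hebox α k (by omega)
    (k + 1) 0 rfl (T * q ^ ((p - 1) * (k + 1))) ?_
  · have h2 : T * q ^ ((p - 1) * (k + 1)) * qi ^ (p * (k + 1)) * expand p hp qi ^ 0 =
        T * qi ^ (k + 1) := by
      obtain ⟨m, rfl⟩ := Nat.exists_eq_succ_of_ne_zero hp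
      have h3 : q ^ (m * (k + 1)) * qi ^ (m * (k + 1)) = 1 := by
        rw [← mul_pow, hq, one_pow]
      rw [Nat.succ_sub_one, Nat.succ_mul, pow_add, pow_zero]
      linear_combination (T * qi ^ (k + 1)) * h3
    rw [h2] at h1
    simpa using h1
  · have hp1 : 1 ≤ p := Nat.one_le_iff_ne_zero.mpr hp
    refine boxLE_mono ?_ ?_ ?_ (mul_mem_boxLE hT (pow_mem_boxLE hqbox _)) <;>
      push_cast [Nat.cast_sub hp1] <;> linarith

end MvPowerSeries

/-! ### Counting the elements of the state space without excess. -/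

namespace MvPowerSeries

/-- The exponents of the numerators over `q ^ (k + 1)`. -/
def digitBox (h d k : ℕ) : Finset (Σ _ : ℕ, ℕ) :=
  (Finset.range (h * (k + 1) + 1)).sigma
    fun a => Finset.Ico (a - k) (a + (d - 1) * (k + 1) + 1)

theorem mem_digitBox {h d k a b : ℕ} : (⟨a, b⟩ : Σ _ : ℕ, ℕ) ∈ digitBox h d k ↔
    a ≤ h * (k + 1) ∧ a ≤ b + k ∧ b ≤ a + (d - 1) * (k + 1) := by
  simp only [digitBox, Finset.mem_sigma, Finset.mem_range, Finset.mem_Ico]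
  omega

theorem two_mul_sum_range_min (k l : ℕ) :
    2 * ∑ a ∈ Finset.range (k + l), min a k + k * (k + 1) = 2 * (k + l) * k := by
  induction l with
  | zero =>
    have h1 : ∑ a ∈ Finset.range (k + 0), min a k = ∑ a ∈ Finset.range k, a :=
      Finset.sum_congr rfl fun a ha => min_eq_left (Finset.mem_range.mp ha).le
    rw [h1, mul_comm 2, Finset.sum_range_id_mul_two]
    rcases k with _ | k
    · rfl
    · simp only [Nat.add_sub_cancel]
      ring
  | succ l ih =>
    rw [← add_assoc, Finset.sum_range_succ, min_eq_right (by omega)]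
    linarith

/-- Each of the `h (k + 1) + 1` values of `a` allows `d (k + 1)` integers `b`, of which `k - a` are
negative when `a < k`; these add up to `k (k + 1) / 2`. The condition `h ≥ 1` ensures that every `a
< k` occurs. -/
theorem two_mul_card_digitBox {h d : ℕ} (hh : 1 ≤ h) (hd : 1 ≤ d) (k : ℕ) :
    2 * (digitBox h d k).card + k * (k + 1) = 2 * (h * (k + 1) + 1) * (d * (k + 1)) := by
  obtain ⟨l, hl⟩ : ∃ l, h * (k + 1) + 1 = k + l := by
    refine exists_add_of_le ?_
    nlinarith
  obtain ⟨d, rfl⟩ := exists_add_of_le hd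
  have h1 : (digitBox h (1 + d) k).card =
      ∑ a ∈ Finset.range (k + l), (d * (k + 1) + 1 + min a k) := by
    rw [digitBox, Finset.card_sigma, hl]
    refine Finset.sum_congr rfl fun a _ => ?_
    rw [Nat.card_Ico, Nat.add_sub_cancel_left]
    omega
  have h2 := two_mul_sum_range_min k l
  rw [h1, Finset.sum_add_distrib, Finset.sum_const, Finset.card_range, smul_eq_mul, hl]
  linarith

variable {R : Type*} [CommRing R] {p α : ℕ} {q qi : MvPowerSeries (Fin 2) R} {h d : ℕ}

/-- The polynomial with prescribed digits on `digitBox h d k`. -/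
noncomputable def digitPolynomial (R : Type*) [CommRing R] {p h d k : ℕ}
    (D : digitBox h d k → Fin p) : MvPowerSeries (Fin 2) R :=
  ofCoeff fun n => if hn : ⟨n 0, n 1⟩ ∈ digitBox h d k then ((D ⟨_, hn⟩ : ℕ) : R) else 0

/-- Numerators of one level form a submodule, so all generators of level `k` merge into a single
fraction. -/
theorem exists_of_mem_stateSpace {h d s t : ℤ} {k : ℕ} {v : MvPowerSeries (Fin 2) R}
    (hv : v ∈ stateSpace p qi h d s t k) :
    ∃ T ∈ boxLE R (h * (k + 1) + s) k ((d - 1) * (k + 1) + t),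
      ∃ w ∈ stateSpace p qi h d s t (k + 1), v = (p : R) ^ k • (T * qi ^ (k + 1)) + w := by
  induction hv using Submodule.span_induction with
  | mem v hv =>
    obtain ⟨i, hi, T, hT, rfl⟩ := hv
    rcases hi.eq_or_lt with rfl | hi
    · exact ⟨T, hT, 0, zero_mem _, (add_zero _).symm⟩
    · exact ⟨0, zero_mem _, _, smul_mem_stateSpace hi hT, by simp⟩
  | zero => exact ⟨0, zero_mem _, 0, zero_mem _, by simp⟩
  | add v v' _ _ ih ih' =>
    obtain ⟨T, hT, w, hw, rfl⟩ := ih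
    obtain ⟨T', hT', w', hw', rfl⟩ := ih'
    refine ⟨T + T', add_mem hT hT', w + w', add_mem hw hw', ?_⟩
    rw [add_mul, smul_add]
    abel
  | smul r v _ ih =>
    obtain ⟨T, hT, w, hw, rfl⟩ := ih
    refine ⟨r • T, Submodule.smul_mem _ _ hT, r • w, Submodule.smul_mem _ _ hw, ?_⟩
    rw [smul_add, smul_mul_assoc, smul_comm]

theorem exists_digitPolynomial (hdigit : ∀ c : R, ∃ x : Fin p, ∃ y : R, c = (x : ℕ) + p * y)
    (hd : 1 ≤ d) {k : ℕ} {T : MvPowerSeries (Fin 2) R}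
    (hT : T ∈ boxLE R (h * (k + 1)) k (((d : ℤ) - 1) * (k + 1))) :
    ∃ D : digitBox h d k → Fin p, ∃ T' ∈ boxLE R (h * (k + 1)) k (((d : ℤ) - 1) * (k + 1)),
      T = digitPolynomial R D + (p : R) • T' := by
  classical
  have hbox : ∀ n : Fin 2 →₀ ℕ, (⟨n 0, n 1⟩ : Σ _ : ℕ, ℕ) ∈ digitBox h d k ↔
      ((n 0 : ℤ) ≤ h * (k + 1) ∧ (n 0 : ℤ) - n 1 ≤ k ∧
        (n 1 : ℤ) - n 0 ≤ ((d : ℤ) - 1) * (k + 1)) := by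
    intro n
    rw [mem_digitBox]
    zify [hd]
    constructor <;> rintro ⟨h1, h2, h3⟩ <;> refine ⟨h1, ?_, ?_⟩ <;> linarith
  choose x y hxy using hdigit
  refine ⟨fun b => x (coeff (Finsupp.equivFunOnFinite.symm ![b.1.1, b.1.2]) T),
    ofCoeff fun n => if (⟨n 0, n 1⟩ : Σ _ : ℕ, ℕ) ∈ digitBox h d k then y (coeff n T) else 0,
    ?_, ?_⟩
  · rw [mem_boxLE]
    intro n hn
    rw [coeff_ofCoeff] at hn
    exact (hbox n).mp (by_contra fun h0 => hn (if_neg h0))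
  · ext n
    rw [map_add, coeff_smul, digitPolynomial, coeff_ofCoeff, coeff_ofCoeff]
    by_cases hn : (⟨n 0, n 1⟩ : Σ _ : ℕ, ℕ) ∈ digitBox h d k
    · rw [dif_pos hn, if_pos hn]
      have : (Finsupp.equivFunOnFinite.symm ![n 0, n 1] : Fin 2 →₀ ℕ) = n := by
        ext i
        fin_cases i <;> rfl
      simp only [this]
      exact hxy _
    · rw [dif_neg hn, if_neg hn, mul_zero, add_zero]
      by_contra h0
      exact hn ((hbox n).mpr (mem_boxLE.mp hT n h0))

/-- An element is determined by the digits of its level `k` numerator and a tail of level `k + 1`: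
the part `p T'` of the numerator is carried over as `p ^ (k + 1) T' q / q ^ (k + 2)`, which fits the
next box. -/
theorem stateSpace_finite_card_step
    (hdigit : ∀ c : R, ∃ x : Fin p, ∃ y : R, c = (x : ℕ) + p * y)
    (hd : 1 ≤ d) (hq : q * qi = 1) (hqbox : q ∈ boxLE R h 1 ((d : ℤ) - 1)) {k : ℕ}
    (hfin : Finite (stateSpace p qi h d 0 0 (k + 1))) :
    Finite (stateSpace p qi h d 0 0 k) ∧ Nat.card (stateSpace p qi h d 0 0 k) ≤
      p ^ (digitBox h d k).card * Nat.card (stateSpace p qi h d 0 0 (k + 1)) := by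
  have hex : ∀ v : stateSpace p qi h d 0 0 k, ∃ x : (digitBox h d k → Fin p) ×
      stateSpace p qi h d 0 0 (k + 1),
      (p : R) ^ k • (digitPolynomial R x.1 * qi ^ (k + 1)) + (x.2 : MvPowerSeries (Fin 2) R) = v := by
    intro v
    obtain ⟨T, hT, w, hw, hv⟩ := exists_of_mem_stateSpace v.2
    rw [add_zero, add_zero] at hT
    obtain ⟨D, T', hT', rfl⟩ := exists_digitPolynomial hdigit hd hT
    have h1 : (p : R) ^ (k + 1) • (T' * q * qi ^ (k + 1 + 1)) ∈
        stateSpace p qi h d 0 0 (k + 1) := by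
      refine smul_mem_stateSpace le_rfl (boxLE_mono ?_ ?_ ?_ (mul_mem_boxLE hT' hqbox)) <;>
        push_cast <;> linarith
    refine ⟨(D, ⟨_, add_mem h1 hw⟩), ?_⟩
    have h2 : T' * q * qi ^ (k + 1 + 1) = T' * qi ^ (k + 1) := by
      linear_combination (T' * qi ^ (k + 1)) * hq
    simp only
    rw [hv, h2, add_mul, smul_add, smul_mul_assoc, smul_smul, pow_succ (p : R), add_assoc]
  choose φ hφ using hex
  have hinj : Function.Injective φ := by
    intro v v' hvv
    apply Subtype.ext
    rw [← hφ v, ← hφ v', hvv]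
  refine ⟨Finite.of_injective φ hinj, (Nat.card_le_card_of_injective φ hinj).trans ?_⟩
  simp

theorem stateSpace_finite_card
    (hdigit : ∀ c : R, ∃ x : Fin p, ∃ y : R, c = (x : ℕ) + p * y) (hpα : (p : R) ^ α = 0)
    (hd : 1 ≤ d) (hq : q * qi = 1) (hqbox : q ∈ boxLE R h 1 ((d : ℤ) - 1)) :
    Finite (stateSpace p qi h d 0 0 0) ∧ Nat.card (stateSpace p qi h d 0 0 0) ≤
      p ^ ∑ k ∈ Finset.range α, (digitBox h d k).card := by
  -- Induction downward from level `α`, where the space is zero because `p ^ α = 0`.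
  have key : ∀ j ≤ α, Finite (stateSpace p qi h d 0 0 (α - j)) ∧
      Nat.card (stateSpace p qi h d 0 0 (α - j)) ≤
        p ^ ∑ k ∈ Finset.Ico (α - j) α, (digitBox h d k).card := by
    intro j
    induction j with
    | zero =>
      intro _
      have : stateSpace p qi h d 0 0 (α - 0) = ⊥ := by
        refine Submodule.span_eq_bot.mpr ?_
        rintro _ ⟨i, hi, T, -, rfl⟩
        rw [pow_eq_zero_of_le (by simpa using hi) hpα, zero_smul]
      rw [this]
      refine ⟨inferInstance, ?_⟩
      simp
    | succ j ih =>
      intro hj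
      obtain ⟨h1, h2⟩ := ih (by omega)
      have h3 : α - j = α - (j + 1) + 1 := by omega
      rw [h3] at h1 h2
      obtain ⟨h4, h5⟩ := stateSpace_finite_card_step hdigit hd hq hqbox h1
      refine ⟨h4, h5.trans ?_⟩
      rw [Finset.sum_eq_sum_Ico_succ_bot (by omega), pow_add]
      exact Nat.mul_le_mul_left _ h2
  have := key α le_rfl
  rwa [Nat.sub_self, ← Finset.range_eq_Ico] at this

end MvPowerSeries

/-! ### Furstenberg's diagonal representation. -/

namespace MvPowerSeries

variable {R : Type*} [CommRing R]

theorem X_mul_X_pow_eq_monomial (k : ℕ) :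
    (X 0 * X 1 : MvPowerSeries (Fin 2) R) ^ k = monomial (diagExponent k) 1 := by
  rw [mul_pow, X_pow_eq, X_pow_eq, monomial_mul_monomial, mul_one]
  have : Finsupp.single (0 : Fin 2) k + Finsupp.single 1 k = diagExponent k := by
    ext i
    fin_cases i <;> simp
  rw [this]

theorem hasSubst_X_mul_X : PowerSeries.HasSubst (X 0 * X 1 : MvPowerSeries (Fin 2) R) :=
  PowerSeries.HasSubst.of_constantCoeff_zero (by simp)

/-- The substitution `f(x) ↦ f(x y)`. -/
noncomputable def diagSubst : PowerSeries R →ₐ[R] MvPowerSeries (Fin 2) R :=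
  PowerSeries.substAlgHom hasSubst_X_mul_X

theorem coeff_diagSubst (f : PowerSeries R) (n : Fin 2 →₀ ℕ) :
    coeff n (diagSubst f) = if n 0 = n 1 then PowerSeries.coeff (n 0) f else 0 := by
  classical
  rw [diagSubst, PowerSeries.coe_substAlgHom, PowerSeries.coeff_subst hasSubst_X_mul_X,
    finsum_eq_single _ (n 0)]
  · rw [X_mul_X_pow_eq_monomial, coeff_monomial]
    have : n = diagExponent (n 0) ↔ n 0 = n 1 := by
      constructor
      · intro h
        have := DFunLike.congr_fun h 1
        exact this.symm
      · intro h
        ext i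
        fin_cases i
        · rfl
        · exact h.symm
    simp [this]
  · intro k hk
    rw [X_mul_X_pow_eq_monomial, coeff_monomial, if_neg, smul_zero]
    rintro rfl
    exact hk rfl

theorem diagSubst_X : diagSubst (PowerSeries.X : PowerSeries R) = X 0 * X 1 := by
  rw [diagSubst, PowerSeries.substAlgHom_X]

/-- The weight `n 0 - n 1`. -/
noncomputable abbrev diagWeight : (Fin 2 →₀ ℕ) →+ ℤ := exponentWeight 0 - exponentWeight 1

theorem diagSubst_mem_weightLE (f : PowerSeries R) :
    diagSubst f ∈ weightLE R diagWeight 0 ∧ diagSubst f ∈ weightLE R (-diagWeight) 0 := by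
  constructor <;>
  · intro n hn
    rw [coeff_diagSubst] at hn
    have : n 0 = n 1 := by_contra fun h => hn (if_neg h)
    simp [this]

theorem X_mem_weightLE {σ : Type*} (i : σ) {w : (σ →₀ ℕ) →+ ℤ} {c : ℤ}
    (h : w (Finsupp.single i 1) ≤ c) : (X i : MvPowerSeries σ R) ∈ weightLE R w c := by
  classical
  intro n hn
  rw [coeff_X] at hn
  have : n = Finsupp.single i 1 := by_contra fun h => hn (if_neg h)
  rwa [this]

/-- The homomorphism `x ↦ x y`, `Y ↦ y`. -/
noncomputable def shear : Polynomial (PowerSeries R) →+* MvPowerSeries (Fin 2) R :=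
  Polynomial.eval₂RingHom (diagSubst : PowerSeries R →ₐ[R] _).toRingHom (X 1)

theorem shear_C (f : PowerSeries R) : shear (Polynomial.C f) = diagSubst f :=
  Polynomial.eval₂_C _ _

theorem shear_X : shear (Polynomial.X : Polynomial (PowerSeries R)) = X 1 :=
  Polynomial.eval₂_X _ _

theorem shear_mem_weightLE (U : Polynomial (PowerSeries R)) :
    shear U ∈ weightLE R diagWeight 0 := by
  induction U using Polynomial.induction_on with
  | C f =>
    rw [shear_C]
    exact (diagSubst_mem_weightLE f).1
  | add f g hf hg =>
    rw [map_add]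
    exact add_mem hf hg
  | monomial n f ih =>
    rw [pow_succ, ← mul_assoc, map_mul, shear_X]
    exact mul_mem_weightLE (c := 0) (c' := 0) ih (X_mem_weightLE 1 (by simp))

/-- A bivariate polynomial as a polynomial in the second variable over power series in the
first. -/
noncomputable def toPolyPowerSeries :
    MvPolynomial (Fin 2) R →ₐ[R] Polynomial (PowerSeries R) :=
  MvPolynomial.aeval ![Polynomial.C PowerSeries.X, Polynomial.X]

theorem derivative_toPolyPowerSeries (P : MvPolynomial (Fin 2) R) :
    Polynomial.derivative (toPolyPowerSeries P) = toPolyPowerSeries (MvPolynomial.pderiv 1 P) := by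
  induction P using MvPolynomial.induction_on with
  | C a =>
    have : toPolyPowerSeries (MvPolynomial.C a) =
        Polynomial.C (algebraMap R (PowerSeries R) a) := by
      rw [toPolyPowerSeries, MvPolynomial.aeval_C, Polynomial.algebraMap_apply]
    rw [this, Polynomial.derivative_C, MvPolynomial.pderiv_C, map_zero]
  | add f g hf hg => rw [map_add, map_add, map_add, map_add, hf, hg]
  | mul_X f i hf =>
    have hX : Polynomial.derivative (toPolyPowerSeries (MvPolynomial.X i : MvPolynomial _ R)) =
        toPolyPowerSeries (MvPolynomial.pderiv 1 (MvPolynomial.X i)) := by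
      fin_cases i <;> simp [toPolyPowerSeries, MvPolynomial.pderiv_X]
    rw [map_mul, Polynomial.derivative_mul, MvPolynomial.pderiv_mul, map_add, map_mul, map_mul, hf,
      hX]

theorem eval_toPolyPowerSeries (P : MvPolynomial (Fin 2) R) (F : PowerSeries R) :
    (toPolyPowerSeries P).eval F = MvPolynomial.aeval ![PowerSeries.X, F] P := by
  induction P using MvPolynomial.induction_on with
  | C a =>
    rw [toPolyPowerSeries, MvPolynomial.aeval_C, Polynomial.algebraMap_apply, Polynomial.eval_C,
      MvPolynomial.aeval_C]
  | add f g hf hg => rw [map_add, Polynomial.eval_add, map_add, hf, hg]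
  | mul_X f i hf =>
    rw [map_mul, Polynomial.eval_mul, map_mul, hf]
    congr 1
    fin_cases i <;> simp [toPolyPowerSeries]

/-- The homomorphism `x ↦ x y`, `y ↦ y` on polynomials. -/
noncomputable def shearPoly : MvPolynomial (Fin 2) R →ₐ[R] MvPowerSeries (Fin 2) R :=
  MvPolynomial.aeval ![X 0 * X 1, X 1]

theorem shear_toPolyPowerSeries (P : MvPolynomial (Fin 2) R) :
    shear (toPolyPowerSeries P) = shearPoly P := by
  induction P using MvPolynomial.induction_on with
  | C a =>
    rw [toPolyPowerSeries, MvPolynomial.aeval_C, Polynomial.algebraMap_apply, shear_C,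
      AlgHom.commutes, shearPoly, MvPolynomial.aeval_C]
  | add f g hf hg => rw [map_add, map_add, map_add, hf, hg]
  | mul_X f i hf =>
    rw [map_mul, map_mul, map_mul, hf]
    congr 1
    fin_cases i
    · simp [toPolyPowerSeries, shearPoly, shear_C, diagSubst_X]
    · simp [toPolyPowerSeries, shearPoly, shear_X]

theorem coeff_diagExponent_of_mem_weightLE {w : (Fin 2 →₀ ℕ) →+ ℤ} {c : ℤ} (hc : c < 0) {k : ℕ}
    (hw : w (diagExponent k) = 0) {f : MvPowerSeries (Fin 2) R} (hf : f ∈ weightLE R w c) :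
    coeff (diagExponent k) f = 0 := by
  by_contra h
  have := hf _ h
  omega

/-- Furstenberg's theorem: an algebraic series is the diagonal of a rational function. -/
theorem coeff_diag_furstenberg {P : MvPolynomial (Fin 2) R} {F : PowerSeries R}
    (hF0 : PowerSeries.constantCoeff F = 0)
    (hF : MvPolynomial.aeval ![PowerSeries.X, F] P = 0) {q qi : MvPowerSeries (Fin 2) R}
    (hq : X 1 * q = shearPoly P) (hqi : q * qi = 1) (n : ℕ) :
    coeff (diagExponent n) (X 1 * shearPoly (MvPolynomial.pderiv 1 P) * qi) =
      PowerSeries.coeff n F := by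
  obtain ⟨U, hU⟩ : Polynomial.X - Polynomial.C F ∣ toPolyPowerSeries P := by
    rw [Polynomial.dvd_iff_isRoot, Polynomial.IsRoot, eval_toPolyPowerSeries, hF]
  obtain ⟨F', rfl⟩ := PowerSeries.X_dvd_iff.mpr hF0
  set g : MvPowerSeries (Fin 2) R := X 0 * diagSubst F' with hg
  have hXg : diagSubst (PowerSeries.X * F') = X 1 * g := by
    rw [map_mul, diagSubst_X, hg]
    ring
  set u := shear U
  set u' := shear (Polynomial.derivative U)
  have hX : ∀ f f' : MvPowerSeries (Fin 2) R, X 1 * f = X 1 * f' → f = f' := by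
    intro f f' h
    ext n
    have h1 := congrArg (coeff (Finsupp.single 1 1 + n)) h
    simpa [X_def, coeff_add_monomial_mul] using h1
  -- From `P = (Y - F) U`, the shear gives `y q = (y - y g) u`, and `y` cancels.
  have h1 : q = (1 - g) * u := by
    apply hX
    rw [hq, ← shear_toPolyPowerSeries, hU, map_mul, map_sub, shear_X, shear_C, hXg]
    ring
  have hD : Polynomial.derivative (Polynomial.X - Polynomial.C (PowerSeries.X * F')) = 1 := by
    rw [Polynomial.derivative_sub, Polynomial.derivative_X, Polynomial.derivative_C, sub_zero]
  have h2 : shearPoly (MvPolynomial.pderiv 1 P) = u + X 1 * (1 - g) * u' := by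
    rw [← shear_toPolyPowerSeries, ← derivative_toPolyPowerSeries, hU, Polynomial.derivative_mul,
      hD, one_mul, map_add, map_mul, map_sub, shear_X, shear_C, hXg]
    ring
  have hinv1 : (1 - g) * (u * qi) = 1 := by rw [← mul_assoc, ← h1, hqi]
  have hinv2 : u * ((1 - g) * qi) = 1 := by
    rw [h1] at hqi
    linear_combination hqi
  have hgw : g ∈ weightLE R (-diagWeight) (-1) := by
    have := mul_mem_weightLE (X_mem_weightLE (R := R) (w := -diagWeight) (c := -1) 0 (by simp))
      (diagSubst_mem_weightLE F').2
    simpa using this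
  have hG : u * qi ∈ weightLE R (-diagWeight) 0 :=
    inverse_mem_weightLE_zero (sub_mem one_mem_weightLE (weightLE_mono (by norm_num) hgw)) hinv1
  have hV : (1 - g) * qi ∈ weightLE R diagWeight 0 :=
    inverse_mem_weightLE_zero (shear_mem_weightLE U) hinv2
  have hX1 : (X 1 : MvPowerSeries (Fin 2) R) ∈ weightLE R diagWeight (-1) :=
    X_mem_weightLE 1 (by simp)
  have hX1' : (X 1 : MvPowerSeries (Fin 2) R) ∈ weightLE R (-diagWeight) 1 :=
    X_mem_weightLE 1 (by simp)
  -- The fraction is `y / (1 - g) + y² u' / u`, and `y / (1 - g) = y + y g + y g² / (1 - g)`. Every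
  -- monomial of `g` has `x`-exponent one above its `y`-exponent, while `u'` and `1 / u` never have
  -- more `x` than `y`. So all terms but `y g = F(xy)` miss the diagonal.
  have h3 : X 1 * shearPoly (MvPolynomial.pderiv 1 P) * qi =
      X 1 + diagSubst (PowerSeries.X * F') + X 1 * (g * g * (u * qi)) +
        X 1 * (X 1 * (u' * ((1 - g) * qi))) := by
    rw [h2, hXg]
    linear_combination (X 1 * (1 + g)) * hinv1
  have h4 : X 1 * (g * g * (u * qi)) ∈ weightLE R (-diagWeight) (-1) :=
    weightLE_mono (by norm_num)
      (mul_mem_weightLE hX1' (mul_mem_weightLE (mul_mem_weightLE hgw hgw) hG))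
  have h5 : X 1 * (X 1 * (u' * ((1 - g) * qi))) ∈ weightLE R diagWeight (-1) :=
    weightLE_mono (by norm_num) (mul_mem_weightLE hX1 (mul_mem_weightLE hX1
        (mul_mem_weightLE (shear_mem_weightLE _) hV)))
  have h6 := coeff_diagExponent_of_mem_weightLE (by norm_num) (k := n) (by simp) hX1
  have h7 := coeff_diagExponent_of_mem_weightLE (by norm_num) (k := n) (by simp) h4
  have h8 := coeff_diagExponent_of_mem_weightLE (by norm_num) (k := n) (by simp) h5
  rw [h3, map_add, map_add, map_add, h6, h7, h8, coeff_diagSubst, diagExponent_apply,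
    diagExponent_apply, if_pos rfl, zero_add, add_zero, add_zero]

end MvPowerSeries

/-! ### The sheared denominator, and the expansion of the fraction in powers of `p`. -/

namespace MvPowerSeries

section

variable {R : Type*} [CommRing R]

/-- The exponent `(a, b)`. -/
noncomputable def pairExponent (a b : ℕ) : Fin 2 →₀ ℕ := Finsupp.equivFunOnFinite.symm ![a, b]

@[simp]
theorem pairExponent_zero (a b : ℕ) : pairExponent a b 0 = a := rfl

@[simp]
theorem pairExponent_one (a b : ℕ) : pairExponent a b 1 = b := rfl

theorem pairExponent_eq_iff {a b : ℕ} {n : Fin 2 →₀ ℕ} :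
    pairExponent a b = n ↔ a = n 0 ∧ b = n 1 := by
  constructor
  · rintro rfl
    exact ⟨rfl, rfl⟩
  · rintro ⟨rfl, rfl⟩
    ext i
    fin_cases i <;> rfl

theorem shearPoly_monomial (m : Fin 2 →₀ ℕ) (a : R) :
    shearPoly (MvPolynomial.monomial m a) = monomial (pairExponent (m 0) (m 0 + m 1)) a := by
  have h1 : Finsupp.single 0 (m 0) + Finsupp.single 1 (m 0) + Finsupp.single 1 (m 1) =
      pairExponent (m 0) (m 0 + m 1) := by
    ext i
    fin_cases i <;> simp
  rw [shearPoly, MvPolynomial.aeval_monomial, Finsupp.prod_fintype _ _ (by simp),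
    Fin.prod_univ_two, ← Algebra.smul_def]
  simp only [Matrix.cons_val_zero, Matrix.cons_val_one]
  rw [mul_pow, X_pow_eq, X_pow_eq, X_pow_eq, monomial_mul_monomial, monomial_mul_monomial,
    ← map_smul, h1]
  simp

theorem coeff_shearPoly (P : MvPolynomial (Fin 2) R) (n : Fin 2 →₀ ℕ) :
    coeff n (shearPoly P) =
      if n 0 ≤ n 1 then MvPolynomial.coeff (pairExponent (n 0) (n 1 - n 0)) P else 0 := by
  classical
  induction P using MvPolynomial.induction_on' with
  | monomial m a =>
    rw [shearPoly_monomial, coeff_monomial, MvPolynomial.coeff_monomial]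
    simp only [eq_comm (a := n), eq_comm (a := m), pairExponent_eq_iff]
    split_ifs <;> first | rfl | omega
  | add f g hf hg =>
    rw [map_add, map_add, hf, hg, MvPolynomial.coeff_add]
    split_ifs <;> simp

/-- The series `P(x y, y) / y`, for `P(0, 0) = 0`. -/
noncomputable def shearQuot (P : MvPolynomial (Fin 2) R) : MvPowerSeries (Fin 2) R :=
  ofCoeff fun n => if n 0 ≤ n 1 + 1 then
    MvPolynomial.coeff (pairExponent (n 0) (n 1 + 1 - n 0)) P else 0

theorem X_mul_shearQuot {P : MvPolynomial (Fin 2) R} (hP : MvPolynomial.coeff 0 P = 0) :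
    X 1 * shearQuot P = shearPoly P := by
  classical
  ext n
  rw [coeff_shearPoly, X_def, coeff_monomial_mul, one_mul, shearQuot, coeff_ofCoeff]
  by_cases h : Finsupp.single 1 1 ≤ n
  · have h1 : 1 ≤ n 1 := by simpa using h 1
    have h2 : n 1 - 1 + 1 = n 1 := by omega
    simp [h, h2]
  · have h1 : n 1 = 0 := by
      by_contra h0
      exact h (Finsupp.single_le_iff.mpr (Nat.one_le_iff_ne_zero.mpr h0))
    rw [if_neg h, h1]
    split_ifs with h2
    · have h3 : pairExponent (n 0) (0 - n 0) = 0 := by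
        rw [pairExponent_eq_iff]
        simp only [Finsupp.coe_zero, Pi.zero_apply]
        omega
      rw [h3, hP]
    · rfl

theorem coeff_shearQuot_ne_zero {P : MvPolynomial (Fin 2) R} {n : Fin 2 →₀ ℕ}
    (hn : coeff n (shearQuot P) ≠ 0) : n 0 ≤ n 1 + 1 ∧
      coeff n (shearQuot P) = MvPolynomial.coeff (pairExponent (n 0) (n 1 + 1 - n 0)) P := by
  rw [shearQuot, coeff_ofCoeff] at *
  have h : n 0 ≤ n 1 + 1 := by_contra fun h => hn (if_neg h)
  exact ⟨h, if_pos h⟩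

theorem le_degreeOf_of_coeff_ne_zero {σ : Type*} {P : MvPolynomial σ R} {m : σ →₀ ℕ}
    (h : MvPolynomial.coeff m P ≠ 0) (i : σ) : m i ≤ P.degreeOf i :=
  MvPolynomial.monomial_le_degreeOf i (MvPolynomial.mem_support_iff.mpr h)

theorem numerator_mem_boxLE (P : MvPolynomial (Fin 2) R) :
    X 1 * shearPoly (MvPolynomial.pderiv 1 P) ∈ boxLE R (P.degreeOf 0) 0 (P.degreeOf 1) := by
  have h1 : (X 1 : MvPowerSeries (Fin 2) R) ∈ boxLE R 0 (-1) 1 :=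
    ⟨⟨X_mem_weightLE 1 (by simp), X_mem_weightLE 1 (by simp)⟩, X_mem_weightLE 1 (by simp)⟩
  have h2 : shearPoly (MvPolynomial.pderiv 1 P) ∈
      boxLE R (P.degreeOf 0) 0 ((P.degreeOf 1 : ℤ) - 1) := by
    rw [mem_boxLE]
    intro n hn
    rw [coeff_shearPoly] at hn
    have h : n 0 ≤ n 1 := by_contra fun h => hn (if_neg h)
    rw [if_pos h, MvPolynomial.coeff_pderiv] at hn
    have h3 := le_degreeOf_of_coeff_ne_zero (left_ne_zero_of_mul hn)
    have h4 := h3 0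
    have h5 := h3 1
    simp at h4 h5
    omega
  exact boxLE_mono (by simp) (by simp) (by simp) (mul_mem_boxLE h1 h2)

/-- Splitting off the coefficients divisible by `p`. -/
theorem exists_eq_add_smul {σ : Type*} (p : R) (f : MvPowerSeries σ R) :
    ∃ f₀ f₁ : MvPowerSeries σ R, f = f₀ + p • f₁ ∧
      (∀ n, ¬ p ∣ coeff n f → coeff n f₀ = coeff n f) ∧
      (∀ n, coeff n f₀ ≠ 0 → ¬ p ∣ coeff n f) ∧ ∀ n, coeff n f₁ ≠ 0 → coeff n f ≠ 0 := by
  classical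
  -- The quotient by `p` need not be unique; choosing `0` for `c = 0` keeps the support of `f₁`
  -- inside that of `f`.
  have hdvd : ∀ c : R, ∃ y : R, (p ∣ c → c = p * y) ∧ (c = 0 → y = 0) ∧ (¬ p ∣ c → y = 0) := by
    intro c
    by_cases h0 : c = 0
    · exact ⟨0, by simp [h0], by simp, by simp⟩
    · by_cases h : p ∣ c
      · obtain ⟨y, hy⟩ := h
        exact ⟨y, fun _ => hy, fun h => (h0 h).elim, fun h => (h ⟨y, hy⟩).elim⟩
      · exact ⟨0, fun h' => (h h').elim, by simp, by simp⟩
  choose y hy using hdvd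
  refine ⟨ofCoeff fun n => if p ∣ coeff n f then 0 else coeff n f, ofCoeff fun n => y (coeff n f),
    ?_, ?_, ?_, ?_⟩
  · ext n
    rw [map_add, coeff_smul, coeff_ofCoeff, coeff_ofCoeff]
    by_cases h : p ∣ coeff n f
    · rw [if_pos h, zero_add]
      exact (hy _).1 h
    · rw [if_neg h, (hy _).2.2 h, mul_zero, add_zero]
  · intro n hn
    rw [coeff_ofCoeff, if_neg hn]
  · intro n hn h
    exact hn (if_pos h)
  · intro n hn h
    exact hn ((hy _).2.1 h)

/-- A fraction with denominator `q` belongs to the state space of `q₀` when `q ≡ q₀ mod p`. -/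
theorem fraction_mem_stateSpace {p α : ℕ} (hpα : (p : R) ^ α = 0)
    {N q qi q₀ qi₀ q₁ : MvPowerSeries (Fin 2) R} {h d H D : ℤ} (hH : h ≤ H) (hD : d ≤ D)
    (hN : N ∈ boxLE R H 0 D) (hq₁ : q₁ ∈ boxLE R H 1 (D - 1)) (hq : q = q₀ + (p : R) • q₁)
    (hqi : q * qi = 1) (hqi₀ : q₀ * qi₀ = 1) :
    N * qi ∈ stateSpace p qi₀ h d (α * (H - h)) (α * (D - d) + 1) 0 := by
  -- These are the remainders of the geometric expansion of `N / (q₀ + p q₁)`; the remainder at `k =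
  -- α` vanishes.
  have key : ∀ j k : ℕ, k + j = α → (p : R) ^ k • (N * q₁ ^ k * qi₀ ^ k * qi) ∈
      stateSpace p qi₀ h d (α * (H - h)) (α * (D - d) + 1) 0 := by
    intro j
    induction j with
    | zero =>
      rintro k rfl
      rw [add_zero] at hpα
      rw [hpα, zero_smul]
      exact zero_mem _
    | succ j ih =>
      intro k hk
      have h1 : N * q₁ ^ k * qi₀ ^ k * qi = N * q₁ ^ k * qi₀ ^ (k + 1) -
          (p : R) • (N * q₁ ^ (k + 1) * qi₀ ^ (k + 1) * qi) := by
        have h2 : (p : R) • (N * q₁ ^ (k + 1) * qi₀ ^ (k + 1) * qi) =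
            N * q₁ ^ k * ((p : R) • q₁) * qi₀ ^ (k + 1) * qi := by
          simp only [mul_smul_comm, smul_mul_assoc, pow_succ, mul_assoc]
        have h3 : (p : R) • q₁ = q - q₀ := by rw [hq]; ring
        rw [h2, h3]
        linear_combination (-N * q₁ ^ k * qi₀ ^ k * qi) * hqi₀ +
          (N * q₁ ^ k * qi₀ ^ (k + 1)) * hqi
      rw [h1, smul_sub, smul_smul, ← pow_succ]
      refine sub_mem (smul_mem_stateSpace (Nat.zero_le k) ?_) (ih (k + 1) (by omega))
      -- The numerator `N q₁ ^ k` has excesses `(k + 1) (H - h)` and `(k + 1) (D - d) + 1`, largest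
      -- at `k = α - 1`. The final `1` arises because `N` allows `D` where `q₁` allows only `D - 1`.
      have hkα : (k : ℤ) + 1 ≤ α := by omega
      have h4 := mul_le_mul_of_nonneg_right hkα (sub_nonneg.mpr hH)
      have h5 := mul_le_mul_of_nonneg_right hkα (sub_nonneg.mpr hD)
      refine boxLE_mono ?_ ?_ ?_ (mul_mem_boxLE hN (pow_mem_boxLE hq₁ k)) <;> linarith
  simpa using key α 0 (zero_add α)

end

/-! ### The kernel bound over `ZMod (p ^ α)`. -/

section ZMod

variable {p : ℕ} [Fact p.Prime] {α : ℕ}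

theorem dvd_of_castHom_eq_zero {c : ZMod (p ^ α)} (hα : 1 ≤ α)
    (hc : ZMod.castHom (dvd_pow_self p (Nat.one_le_iff_ne_zero.mp hα)) (ZMod p) c = 0) :
    (p : ZMod (p ^ α)) ∣ c := by
  have : NeZero (p ^ α) := ⟨pow_ne_zero _ (Fact.out : p.Prime).ne_zero⟩
  rw [← ZMod.natCast_zmod_val c, map_natCast, ZMod.natCast_eq_zero_iff] at hc
  obtain ⟨k, hk⟩ := hc
  exact ⟨k, by rw [← ZMod.natCast_zmod_val c, hk, Nat.cast_mul]⟩

theorem exists_digit (c : ZMod (p ^ α)) :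
    ∃ x : Fin p, ∃ y : ZMod (p ^ α), c = (x : ℕ) + p * y := by
  have : NeZero (p ^ α) := ⟨pow_ne_zero _ (Fact.out : p.Prime).ne_zero⟩
  refine ⟨⟨c.val % p, Nat.mod_lt _ (Fact.out : p.Prime).pos⟩, (c.val / p : ℕ), ?_⟩
  rw [← Nat.cast_mul, ← Nat.cast_add, Nat.mod_add_div, ZMod.natCast_zmod_val]

/-- Modulo `p`, Frobenius fixes the coefficients in `ZMod p`, so `q ^ p` and `expand q` agree. Both
lie in the `p`-fold box, and the quotient of their difference by `p` can be chosen without new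
exponents. -/
theorem exists_pow_eq_expand_add (hα : 1 ≤ α) {h d : ℤ}
    {q : MvPowerSeries (Fin 2) (ZMod (p ^ α))} (hq : q ∈ boxLE _ h 1 (d - 1)) :
    ∃ e ∈ boxLE (ZMod (p ^ α)) (p * h) p (p * (d - 1)),
      q ^ p = expand p (Fact.out : p.Prime).ne_zero q + (p : ZMod (p ^ α)) • e := by
  have hp := (Fact.out : p.Prime).ne_zero
  set φ := ZMod.castHom (dvd_pow_self p (Nat.one_le_iff_ne_zero.mp hα)) (ZMod p)
  obtain ⟨f₀, f₁, hf, -, hf₀, hf₁⟩ := exists_eq_add_smul (p : ZMod (p ^ α)) (q ^ p - expand p hp q)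
  have hdvd : ∀ n, (p : ZMod (p ^ α)) ∣ coeff n (q ^ p - expand p hp q) := by
    intro n
    apply dvd_of_castHom_eq_zero hα
    rw [← coeff_map, map_sub, map_pow, map_expand, ← map_frobenius_expand p hp,
      ZMod.frobenius_zmod, map_id, RingHom.id_apply, sub_self, map_zero]
  have h0 : f₀ = 0 := by
    ext n
    by_contra h
    exact hf₀ n h (hdvd n)
  refine ⟨f₁, ?_, ?_⟩
  · have h1 : q ^ p - expand p hp q ∈ boxLE (ZMod (p ^ α)) (p * h) p (p * (d - 1)) := by
      refine sub_mem ?_ ?_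
      · simpa using pow_mem_boxLE hq p
      · simpa using expand_mem_boxLE hp hq
    rw [mem_boxLE] at h1 ⊢
    exact fun n hn => h1 n (hf₁ n hn)
  · rw [h0, zero_add] at hf
    rw [← hf]
    ring

/-- The subsequence `a (p ^ e * n + r)` of the diagonal is the diagonal of an element of a state
space whose degree excess is divided by `p ^ e`. -/
theorem exists_mem_stateSpace_subsequence {q qi ε v : MvPowerSeries (Fin 2) (ZMod (p ^ α))}
    {h d s t : ℤ} (hq : q * qi = 1)
    (hε : q ^ p = expand p (Fact.out : p.Prime).ne_zero q + (p : ZMod (p ^ α)) • ε)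
    (hεbox : ε ∈ boxLE _ (p * h) p (p * (d - 1))) (hqbox : q ∈ boxLE _ h 1 (d - 1))
    (hv : v ∈ stateSpace p qi h d s t 0) (e : ℕ) : ∀ r < p ^ e,
    ∃ w ∈ stateSpace p qi h d (s / (p ^ e : ℕ)) (t / (p ^ e : ℕ)) 0,
      ∀ n, coeff (diagExponent (p ^ e * n + r)) v = coeff (diagExponent n) w := by
  have hp := (Fact.out : p.Prime).pos
  have hpα : (p : ZMod (p ^ α)) ^ α = 0 := by
    rw [← Nat.cast_pow, ZMod.natCast_self]
  induction e with
  | zero =>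
    intro r hr
    have : r = 0 := by simpa using hr
    subst this
    exact ⟨v, by simpa using hv, by simp⟩
  | succ e ih =>
    intro r hr
    obtain ⟨w, hw, hvw⟩ := ih (r % p ^ e) (Nat.mod_lt _ (pow_pos hp e))
    have hr' : r / p ^ e < p := Nat.div_lt_of_lt_mul (by rwa [pow_succ] at hr)
    refine ⟨cartier p (diagExponent (r / p ^ e)) w, ?_, fun n => ?_⟩
    · have := cartier_mem_stateSpace hp.ne' hpα hr' hq hε hεbox hqbox hw
      rwa [Int.ediv_ediv_of_nonneg (by positivity), Int.ediv_ediv_of_nonneg (by positivity),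
        ← Nat.cast_mul, ← pow_succ] at this
    -- The low `e` base-`p` digits of `r` are handled by induction, and the last Cartier operator
    -- extracts the top digit.
    · have h1 : p ^ (e + 1) * n + r = p ^ e * (p * n + r / p ^ e) + r % p ^ e := by
        have := Nat.div_add_mod r (p ^ e)
        rw [pow_succ]
        linarith
      have h2 : p • diagExponent n + diagExponent (r / p ^ e) =
          diagExponent (p * n + r / p ^ e) := by
        ext i
        simp
      rw [h1, hvw, coeff_cartier, h2]

theorem sum_card_digitBox {h d : ℕ} (hh : 1 ≤ h) (hd : 1 ≤ d) (α : ℕ) :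
    ((∑ k ∈ Finset.range α, (digitBox h d k).card : ℕ) : ℝ) =
      (1 / 6 : ℝ) * (α : ℝ) * ((α : ℝ) + 1) *
        ((2 * (h : ℝ) * (d : ℝ) - 1) * (α : ℝ) + ((h : ℝ) + 3) * (d : ℝ) + 1) := by
  induction α with
  | zero => simp
  | succ k ih =>
    have h1 : (2 * (digitBox h d k).card + k * (k + 1) : ℝ) =
        2 * (h * (k + 1) + 1) * (d * (k + 1)) := mod_cast two_mul_card_digitBox hh hd k
    rw [Finset.sum_range_succ, Nat.cast_add, ih]
    push_cast
    linarith

theorem pKernel_finite_ncard_le_of_zmod (hα : 1 ≤ α) {P : MvPolynomial (Fin 2) (ZMod (p ^ α))}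
    {F : PowerSeries (ZMod (p ^ α))} (hF0 : PowerSeries.constantCoeff F = 0)
    (hF : MvPolynomial.aeval ![PowerSeries.X, F] P = 0) (hP0 : MvPolynomial.coeff 0 P = 0)
    (hP1 : IsUnit (MvPolynomial.coeff (Finsupp.single 1 1) P))
    (hP1' : ¬ (p : ZMod (p ^ α)) ∣ MvPolynomial.coeff (Finsupp.single 1 1) P)
    {h d : ℕ} (hd : 1 ≤ d)
    (hdeg : ∀ m, ¬ (p : ZMod (p ^ α)) ∣ MvPolynomial.coeff m P → m 0 ≤ h ∧ m 1 ≤ d)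
    (hH : h ≤ P.degreeOf 0) (hD : d ≤ P.degreeOf 1) {u : ℕ}
    (hu0 : (α * (P.degreeOf 0 - h) : ℤ) < (p ^ u : ℕ))
    (hu1 : (α * (P.degreeOf 1 - d) + 1 : ℤ) < (p ^ u : ℕ)) :
    (pKernel p fun n => PowerSeries.coeff n F).Finite ∧
    (pKernel p fun n => PowerSeries.coeff n F).ncard ≤
      p ^ ∑ k ∈ Finset.range α, (digitBox h d k).card + ∑ e ∈ Finset.range u, p ^ e := by
  classical
  have hp := (Fact.out : p.Prime).pos
  have hpα : (p : ZMod (p ^ α)) ^ α = 0 := by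
    rw [← Nat.cast_pow, ZMod.natCast_self]
  set q := shearQuot P with hqdef
  obtain ⟨q₀, q₁, hq, hq₀, hq₀', hq₁⟩ := exists_eq_add_smul (p : ZMod (p ^ α)) q
  have hc : coeff 0 q = MvPolynomial.coeff (Finsupp.single 1 1) P := by
    have : pairExponent 0 1 = Finsupp.single 1 1 := by
      rw [pairExponent_eq_iff]
      simp
    rw [hqdef, shearQuot, coeff_ofCoeff, ← this]
    simp
  -- The constant coefficient is prime to `p`, hence is kept in `q₀`, which is therefore invertible
  -- too.
  have hc₀ : coeff 0 q₀ = coeff 0 q := hq₀ 0 (by rwa [hc])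
  obtain ⟨qi, hqi⟩ : ∃ qi, q * qi = 1 := by
    refine IsUnit.exists_right_inv (isUnit_iff_constantCoeff.mpr ?_)
    rwa [← coeff_zero_eq_constantCoeff_apply, hc]
  obtain ⟨qi₀, hqi₀⟩ : ∃ qi₀, q₀ * qi₀ = 1 := by
    refine IsUnit.exists_right_inv (isUnit_iff_constantCoeff.mpr ?_)
    rwa [← coeff_zero_eq_constantCoeff_apply, hc₀, hc]
  have hq₀box : q₀ ∈ boxLE (ZMod (p ^ α)) h 1 ((d : ℤ) - 1) := by
    rw [mem_boxLE]
    intro n hn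
    have h1 := hq₀' n hn
    obtain ⟨h2, h3⟩ := coeff_shearQuot_ne_zero (P := P) (n := n)
      fun h0 => h1 (by rw [hqdef, h0]; exact dvd_zero _)
    rw [hqdef, h3] at h1
    obtain ⟨h4, h5⟩ := hdeg _ h1
    rw [pairExponent_zero] at h4
    rw [pairExponent_one] at h5
    omega
  have hq₁box : q₁ ∈ boxLE (ZMod (p ^ α)) (P.degreeOf 0) 1 ((P.degreeOf 1 : ℤ) - 1) := by
    rw [mem_boxLE]
    intro n hn
    have h1 := hq₁ n hn
    obtain ⟨h2, h3⟩ := coeff_shearQuot_ne_zero h1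
    rw [hqdef, h3] at h1
    have h4 := le_degreeOf_of_coeff_ne_zero h1 0
    have h5 := le_degreeOf_of_coeff_ne_zero h1 1
    rw [pairExponent_zero] at h4
    rw [pairExponent_one] at h5
    omega
  have hv := fraction_mem_stateSpace hpα (Int.ofNat_le.mpr hH) (Int.ofNat_le.mpr hD)
    (numerator_mem_boxLE P) hq₁box hq hqi hqi₀
  have hdiag := coeff_diag_furstenberg hF0 hF (X_mul_shearQuot hP0) hqi
  obtain ⟨ε, hεbox, hε⟩ := exists_pow_eq_expand_add hα hq₀box
  obtain ⟨hfin, hcard⟩ := stateSpace_finite_card (exists_digit (p := p) (α := α)) hpα hd hqi₀ hq₀box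
  set S : Set (MvPowerSeries (Fin 2) (ZMod (p ^ α))) := SetLike.coe (stateSpace p qi₀ h d 0 0 0)
  set A : Set (ℕ → ZMod (p ^ α)) := (fun v n => coeff (diagExponent n) v) '' S
  set I : Finset (Σ _ : ℕ, ℕ) := (Finset.range u).sigma fun e => Finset.range (p ^ e)
  set B : Finset (ℕ → ZMod (p ^ α)) :=
    I.image fun x n => PowerSeries.coeff (p ^ x.1 * n + x.2) F
  have hSfin : S.Finite := hfin
  have hsub : (pKernel p fun n => PowerSeries.coeff n F) ⊆ A ∪ B := by
    rintro _ ⟨e, r, hr, rfl⟩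
    by_cases he : e < u
    · refine Or.inr (Finset.mem_coe.mpr (Finset.mem_image.mpr ⟨⟨e, r⟩, ?_, rfl⟩))
      exact Finset.mem_sigma.mpr ⟨Finset.mem_range.mpr he, Finset.mem_range.mpr hr⟩
    · obtain ⟨w, hw, hvw⟩ :=
        exists_mem_stateSpace_subsequence hqi₀ hε hεbox hq₀box hv e r hr
      have hpow : ((p ^ u : ℕ) : ℤ) ≤ (p ^ e : ℕ) :=
        Int.ofNat_le.mpr (Nat.pow_le_pow_right hp (not_lt.mp he))
      have hH' : (0 : ℤ) ≤ α * (P.degreeOf 0 - h) :=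
        mul_nonneg (by positivity) (sub_nonneg.mpr (Int.ofNat_le.mpr hH))
      have hD' : (0 : ℤ) ≤ α * (P.degreeOf 1 - d) :=
        mul_nonneg (by positivity) (sub_nonneg.mpr (Int.ofNat_le.mpr hD))
      -- Both excesses are nonnegative and below `p ^ u ≤ p ^ e`, so their quotients by `p ^ e` are
      -- zero.
      rw [Int.ediv_eq_zero_of_lt hH' (hu0.trans_le hpow),
        Int.ediv_eq_zero_of_lt (by linarith) (hu1.trans_le hpow)] at hw
      refine Or.inl ⟨w, hw, funext fun n => ?_⟩
      simp only
      rw [← hvw, hdiag]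
  have hABfin : (A ∪ B).Finite := (hSfin.image _).union B.finite_toSet
  refine ⟨hABfin.subset hsub, (Set.ncard_le_ncard hsub hABfin).trans
    ((Set.ncard_union_le _ _).trans (add_le_add ?_ ?_))⟩
  · exact (Set.ncard_image_le hSfin).trans hcard
  · rw [Set.ncard_coe_finset]
    refine Finset.card_image_le.trans ?_
    rw [Finset.card_sigma]
    simp

end ZMod

end MvPowerSeries

/-! ### Reduction from the `p`-adic integers to `ZMod (p ^ α)`. -/

theorem aeval_map_powerSeries {A B : Type*} [CommRing A] [CommRing B] (φ : A →+* B)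
    (P : MvPolynomial (Fin 2) A) (F : PowerSeries A) :
    MvPolynomial.aeval ![PowerSeries.X, PowerSeries.map φ F] (MvPolynomial.map φ P) =
      PowerSeries.map φ (MvPolynomial.aeval ![PowerSeries.X, F] P) := by
  induction P using MvPolynomial.induction_on with
  | C a =>
    rw [MvPolynomial.map_C, MvPolynomial.aeval_C, MvPolynomial.aeval_C]
    exact (PowerSeries.map_C φ a).symm
  | add f g hf hg => rw [map_add, map_add, map_add, map_add, hf, hg]
  | mul_X f i hf =>
    rw [map_mul, map_mul, map_mul, map_mul, hf]
    congr 1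
    fin_cases i <;> simp

section PadicInt

variable {p : ℕ} [Fact p.Prime] {α : ℕ}

theorem toZMod_natCast_mul (z : ℤ_[p]) : PadicInt.toZMod ((p : ℤ_[p]) * z) = 0 := by
  rw [map_mul, map_natCast, ZMod.natCast_self, zero_mul]

theorem toZMod_eq_zero_of_toZModPow_eq_zero (hα : 1 ≤ α) {z : ℤ_[p]}
    (hz : PadicInt.toZModPow α z = 0) : PadicInt.toZMod z = 0 := by
  rw [← RingHom.mem_ker, PadicInt.ker_toZModPow, Ideal.mem_span_singleton] at hz
  obtain ⟨y, rfl⟩ := (dvd_pow_self (p : ℤ_[p]) (Nat.one_le_iff_ne_zero.mp hα)).trans hz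
  exact toZMod_natCast_mul y

theorem toZMod_eq_zero_of_dvd_toZModPow (hα : 1 ≤ α) {z : ℤ_[p]}
    (hz : (p : ZMod (p ^ α)) ∣ PadicInt.toZModPow α z) : PadicInt.toZMod z = 0 := by
  obtain ⟨c, hc⟩ := hz
  obtain ⟨y, rfl⟩ := ZMod.ringHom_surjective (PadicInt.toZModPow (p := p) α) c
  have h1 : PadicInt.toZModPow α (z - (p : ℤ_[p]) * y) = 0 := by
    rw [map_sub, map_mul, map_natCast, hc, sub_self]
  have h2 := toZMod_eq_zero_of_toZModPow_eq_zero hα h1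
  rwa [map_sub, toZMod_natCast_mul, sub_zero] at h2

theorem dvd_toZModPow_of_toZMod_eq_zero {z : ℤ_[p]} (hz : PadicInt.toZMod z = 0) :
    (p : ZMod (p ^ α)) ∣ PadicInt.toZModPow α z := by
  rw [← RingHom.mem_ker, PadicInt.ker_toZMod, PadicInt.maximalIdeal_eq_span_p,
    Ideal.mem_span_singleton] at hz
  obtain ⟨y, rfl⟩ := hz
  exact ⟨PadicInt.toZModPow α y, by rw [map_mul, map_natCast]⟩

theorem isUnit_of_toZMod_ne_zero {z : ℤ_[p]} (hz : PadicInt.toZMod z ≠ 0) : IsUnit z := by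
  by_contra h
  exact hz (by rwa [← RingHom.mem_ker, PadicInt.ker_toZMod, IsLocalRing.mem_maximalIdeal])

theorem degreeOf_map_toZMod_le (hα : 1 ≤ α) {σ : Type*} (P : MvPolynomial σ ℤ_[p]) (i : σ) :
    (MvPolynomial.map PadicInt.toZMod P).degreeOf i ≤
      (MvPolynomial.map (PadicInt.toZModPow α) P).degreeOf i := by
  rw [MvPolynomial.degreeOf_le_iff]
  intro m hm
  rw [MvPolynomial.mem_support_iff, MvPolynomial.coeff_map] at hm
  refine MvPowerSeries.le_degreeOf_of_coeff_ne_zero (fun h => hm ?_) i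
  rw [MvPolynomial.coeff_map] at h
  exact toZMod_eq_zero_of_toZModPow_eq_zero hα h

end PadicInt

theorem mainTheorem10 (p : ℕ) [Fact p.Prime] (α : ℕ) (hα : 1 ≤ α)
    (P : MvPolynomial (Fin 2) ℤ_[p]) (F : PowerSeries ℤ_[p]) (hF : IsFurstenbergSeries P F)
    (h d : ℕ)
    (hh : h = (MvPolynomial.map PadicInt.toZMod P).degreeOf 0) (hh1 : 1 ≤ h)
    (hd : d = (MvPolynomial.map PadicInt.toZMod P).degreeOf 1) (hd1 : 1 ≤ d)
    (u : ℤ)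
    (hu : u = ⌊Real.logb p (max
      ((α : ℝ) * (((MvPolynomial.map (PadicInt.toZModPow α) P).degreeOf 0 : ℝ) - (h : ℝ)))
      ((α : ℝ) * (((MvPolynomial.map (PadicInt.toZModPow α) P).degreeOf 1 : ℝ) - (d : ℝ))
        + 1))⌋ + 1) :
    (pKernel p (fun n => PadicInt.toZModPow α (PowerSeries.coeff n F))).Finite ∧
    ((pKernel p (fun n => PadicInt.toZModPow α (PowerSeries.coeff n F))).ncard : ℝ) ≤
      (p : ℝ) ^ ((1 / 6 : ℝ) * (α : ℝ) * ((α : ℝ) + 1) *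
          ((2 * (h : ℝ) * (d : ℝ) - 1) * (α : ℝ) + ((h : ℝ) + 3) * (d : ℝ) + 1))
        + ((p : ℝ) ^ u - 1) / ((p : ℝ) - 1) := by
  have hp := (Fact.out : p.Prime)
  have hp1 : (1 : ℝ) < p := mod_cast hp.one_lt
  have hH := degreeOf_map_toZMod_le hα P 0
  have hD := degreeOf_map_toZMod_le hα P 1
  rw [← hh] at hH
  rw [← hd] at hD
  set P' := MvPolynomial.map (PadicInt.toZModPow α) P with hP'
  set M : ℝ := max ((α : ℝ) * ((P'.degreeOf 0 : ℝ) - h)) ((α : ℝ) * ((P'.degreeOf 1 : ℝ) - d) + 1)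
  -- The `+ 1` in the second term of the maximum makes the logarithm nonnegative, so `u` is a
  -- natural number and `M < p ^ u`.
  have hM1 : 1 ≤ M := by
    refine le_trans ?_ (le_max_right _ _)
    have : (0 : ℝ) ≤ (P'.degreeOf 1 : ℝ) - d := sub_nonneg.mpr (mod_cast hD)
    have := mul_nonneg (Nat.cast_nonneg (α := ℝ) α) this
    linarith
  have hu0 : 0 ≤ u := by
    have := Int.floor_nonneg.mpr (Real.logb_nonneg hp1 hM1)
    omega
  obtain ⟨U, rfl⟩ := Int.eq_ofNat_of_zero_le hu0
  have hMU : M < (p : ℝ) ^ U := by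
    have h1 : Real.logb p M < (U : ℝ) := by
      have := Int.lt_floor_add_one (Real.logb p M)
      have h2 : ((U : ℤ) : ℝ) = (⌊Real.logb p M⌋ : ℝ) + 1 := by rw [hu]; push_cast; rfl
      rw [Int.cast_natCast] at h2
      rwa [h2]
    rw [Real.logb_lt_iff_lt_rpow hp1 (by linarith)] at h1
    rwa [Real.rpow_natCast] at h1
  have hMU0 : (α * (P'.degreeOf 0 - h) : ℤ) < (p ^ U : ℕ) := by
    have := (le_max_left _ _).trans_lt hMU
    exact_mod_cast this
  have hMU1 : (α * (P'.degreeOf 1 - d) + 1 : ℤ) < (p ^ U : ℕ) := by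
    have := (le_max_right _ _).trans_lt hMU
    exact_mod_cast this
  have hc0 : MvPolynomial.coeff 0 P = 0 := by
    rw [← MvPolynomial.constantCoeff_eq, ← MvPolynomial.eval_zero']
    exact hF.eval_zero
  have hc1 : PadicInt.toZMod (MvPolynomial.coeff (Finsupp.single 1 1) P) ≠ 0 := by
    have h1 := hF.pderiv_ne_zero
    have h2 : MvPolynomial.eval (fun _ => 0) (MvPolynomial.pderiv 1 P) =
        MvPolynomial.coeff (Finsupp.single 1 1) P := by
      have h3 : MvPolynomial.eval (fun _ => 0) (MvPolynomial.pderiv 1 P) =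
          MvPolynomial.constantCoeff (MvPolynomial.pderiv 1 P) := by
        rw [← MvPolynomial.eval_zero']
      rw [h3, MvPolynomial.constantCoeff_eq, MvPolynomial.coeff_pderiv]
      simp
    rwa [h2] at h1
  have hdeg : ∀ m, ¬ (p : ZMod (p ^ α)) ∣ MvPolynomial.coeff m P' → m 0 ≤ h ∧ m 1 ≤ d := by
    intro m hm
    have h1 : MvPolynomial.coeff m (MvPolynomial.map PadicInt.toZMod P) ≠ 0 := by
      intro h0
      rw [MvPolynomial.coeff_map] at h0
      rw [hP', MvPolynomial.coeff_map] at hm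
      exact hm (dvd_toZModPow_of_toZMod_eq_zero h0)
    rw [hh, hd]
    exact ⟨MvPowerSeries.le_degreeOf_of_coeff_ne_zero h1 0,
      MvPowerSeries.le_degreeOf_of_coeff_ne_zero h1 1⟩
  have hF0 : PowerSeries.constantCoeff (PowerSeries.map (PadicInt.toZModPow α) F) = 0 := by
    rw [← PowerSeries.coeff_zero_eq_constantCoeff_apply, PowerSeries.coeff_map,
      PowerSeries.coeff_zero_eq_constantCoeff_apply, hF.constantCoeff_eq_zero, map_zero]
  obtain ⟨hfin, hcard⟩ := MvPowerSeries.pKernel_finite_ncard_le_of_zmod hα (P := P')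
    (F := PowerSeries.map (PadicInt.toZModPow α) F) hF0
    (by rw [hP', aeval_map_powerSeries, hF.annihilates, map_zero])
    (by rw [hP', MvPolynomial.coeff_map, hc0, map_zero])
    (by
      rw [hP', MvPolynomial.coeff_map]
      exact (isUnit_of_toZMod_ne_zero hc1).map _)
    (fun h0 => hc1 (toZMod_eq_zero_of_dvd_toZModPow hα (by
      rwa [hP', MvPolynomial.coeff_map] at h0)))
    hd1 hdeg hH hD hMU0 hMU1
  simp only [PowerSeries.coeff_map] at hfin hcard
  refine ⟨hfin, ?_⟩
  rw [← MvPowerSeries.sum_card_digitBox hh1 hd1, Real.rpow_natCast, zpow_natCast,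
    ← geom_sum_eq hp1.ne']
  exact_mod_cast hcard
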